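/- Let $f(x)=\sum_{\sigma\in\mathbb{Q}_{>0}}c_\sigma x^\sigma$ be a formal Puiseux series over $\mathbb{C}$ (exponents with a common denominator) with vanishing constant coefficient; for instance $f\in x\,\mathbb{C}[[x^{\mathbb{Q}^+}]]$. A formal series is called holonomic if it is annihilated by a nonzero operator in $\mathbb{C}[x][d/dx]$. Let $\hat f(\zeta)=\sum_\sigma \frac{c_\sigma}{\Gamma(\sigma)}\zeta^{\sigma-1}$ be the Borel transform of $f$, and suppose that $f$ is holonomic. Then: (i) The formal series $\hat f$ is holonomic, i.e. $\hat H(\hat f)=0$ for some nonzero $\hat H\in\mathbb{C}[\zeta][d/d\zeta]$. (ii) Suppose in addition that $|c_\sigma/\Gamma(\sigma)|\le A B^\sigma$ for some $A,B>0$ and all $\sigma>0$. Then $\hat f$ converges near the origin of the Riemann surface $\mathbb{C}_\bullet$ of the logarithm. For every nonzero $\hat H\in\mathbb{C}[\zeta][d/d\zeta]$ with $\hat H(\hat f)=0$, the set $\Omega$ of its singular points (the zeros in $\mathbb{C}$ of the coefficient of the derivative of highest order) is finite, and $\hat f$ is the minor of an integrable resurgent function whose singularities all lie over $\Omega$. This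 means that, for some $r>0$: - $\hat f$ is analytic on the part of $\mathbb{C}_\bullet$ over $0<|\zeta|<r$, and it is integrable at $0$ along every ray; - there is an analytic function $\check f$ on the same domain (a major) with $\hat f(\zeta)=\check f(\zeta)-\check f(e^{-2\pi i}\zeta)$ and $\zeta\check f(\zeta)\to0$ as $\zeta\to0$, uniformly in sectors of bounded opening; - the germ of $\hat f$ at any point of $\mathbb{C}_\bullet$ over $0<|\zeta|<r$ can be continued analytically along every path in $\mathbb{C}\setminus\Omega$ that starts at the projection of that point. In particular, the analytic continuation of $\hat f$ has singularities over only finitely many points of $\mathbb{C}$. -/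

import Mathlib

open scoped Topology

noncomputable section

namespace Resurgence

/-! ### Formal series with rational exponents, and formal holonomy

A formal series `∑ c_σ x^σ` with rational exponents is a Hahn series `f : HahnSeries ℚ ℂ`,
where `f.coeff σ = c_σ`. -/

/-- Puiseux series: the exponents have a common denominator. -/
def IsPuiseux (f : HahnSeries ℚ ℂ) : Prop :=
  ∃ N : ℕ, 0 < N ∧ ∀ σ ∈ f.support, ∃ k : ℤ, σ = (k : ℚ) / (N : ℚ)

lemma isPWO_support_shift (f : HahnSeries ℚ ℂ) (a : ℚ → ℂ) :
    (Function.support fun τ : ℚ => a τ * f.coeff (τ + 1)).IsPWO := by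
  have hm : Monotone fun σ : ℚ => σ - 1 := fun x y h => by simpa using h
  refine (f.isPWO_support.image_of_monotone hm).mono ?_
  intro τ hτ
  refine ⟨τ + 1, ?_, by simp⟩
  exact right_ne_zero_of_mul hτ

/-- Termwise derivative: `x^σ ↦ σ x^(σ-1)`. -/
def formalDeriv (f : HahnSeries ℚ ℂ) : HahnSeries ℚ ℂ where
  coeff τ := ((τ + 1 : ℚ) : ℂ) * f.coeff (τ + 1)
  isPWO_support' := isPWO_support_shift f fun τ => ((τ + 1 : ℚ) : ℂ)

/-- A polynomial `a(x)` seen as a formal series. -/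
def ofPoly (a : Polynomial ℂ) : HahnSeries ℚ ℂ :=
  Polynomial.aeval (HahnSeries.single (1 : ℚ) (1 : ℂ)) a

/-- A linear differential operator `∑ aᵢ(x) (d/dx)ⁱ` with polynomial coefficients is given by the
list of the `aᵢ`, stored as the coefficients of a polynomial over `ℂ[x]`. This is its action on
formal series, `f ↦ ∑ aᵢ(x) f⁽ⁱ⁾(x)`. -/
def applyOp (H : Polynomial (Polynomial ℂ)) (f : HahnSeries ℚ ℂ) : HahnSeries ℚ ℂ :=
  ∑ i ∈ Finset.range (H.natDegree + 1), ofPoly (H.coeff i) * formalDeriv^[i] f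

/-- `f` solves a nontrivial linear ODE with polynomial coefficients. -/
def IsHolonomic (f : HahnSeries ℚ ℂ) : Prop :=
  ∃ H : Polynomial (Polynomial ℂ), H ≠ 0 ∧ applyOp H f = 0

/-- The singular points in `ℂ` of the equation `H(y) = 0`: the zeros of the coefficient of the
derivative of highest order. -/
def singularPoints (H : Polynomial (Polynomial ℂ)) : Set ℂ :=
  {ζ | H.leadingCoeff.eval ζ = 0}

/-! ### The Borel transform -/

/-- The formal Borel transform `∑ c_σ x^σ ↦ ∑ c_σ ζ^(σ-1) / Γ(σ)`. -/
def borelTransform (f : HahnSeries ℚ ℂ) : HahnSeries ℚ ℂ where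
  coeff τ := (Complex.Gamma ((τ + 1 : ℚ) : ℂ))⁻¹ * f.coeff (τ + 1)
  isPWO_support' := isPWO_support_shift f fun τ => (Complex.Gamma ((τ + 1 : ℚ) : ℂ))⁻¹

/-- Geometric growth estimates `|c_σ / Γ(σ)| ≤ A B^σ`. -/
def GeometricGrowth (f : HahnSeries ℚ ℂ) : Prop :=
  ∃ A B : ℝ, 0 < A ∧ 0 < B ∧
    ∀ σ : ℚ, 0 < σ → ‖f.coeff σ / Complex.Gamma (σ : ℂ)‖ ≤ A * B ^ (σ : ℝ)

/-! ### Germs at the origin of the Riemann surface of the logarithm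

The Riemann surface of the logarithm is identified with `ℂ` by the coordinate `w = log ζ`, so that
`ζ^τ = exp (τ w)`; the lift of the pointed disk `0 < |ζ| < exp R` is the half plane `Re w < R`, and
`w - 2πi` is the point `e^(-2πi) ζ`. -/

/-- The terms `b_τ ζ^τ`, where `ζ = exp w`, of a formal series `∑ b_τ ζ^τ`. -/
def term (g : HahnSeries ℚ ℂ) (w : ℂ) (τ : ℚ) : ℂ :=
  g.coeff τ * Complex.exp ((τ : ℂ) * w)

/-- The sum of a formal series `∑ b_τ ζ^τ`, as a function of `w = log ζ`. -/
def formalSum (g : HahnSeries ℚ ℂ) (w : ℂ) : ℂ := ∑' τ : ℚ, term g w τ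

/-- `F t` is an analytic germ at `γ t` for each `t`, and these germs are locally given by one
function: `F` is an analytic continuation of the germ `F 0` along `γ`. -/
def IsContinuationAlong (γ : C(unitInterval, ℂ)) (F : unitInterval → ℂ → ℂ) : Prop :=
  (∀ t, AnalyticAt ℂ (F t) (γ t)) ∧ ∀ t, ∀ᶠ s in 𝓝 t, F s =ᶠ[𝓝 (γ s)] F t

/-- The germ `φ` (on `Re w < R`, with `w = log ζ`) can be continued analytically along every path
of the `ζ`-plane that starts over the pointed disk `0 < |ζ| < exp R`, on any sheet, and avoids
`Ω`. -/
def ContinuableOff (φ : ℂ → ℂ) (R : ℝ) (Ω : Set ℂ) : Prop :=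
  ∀ w₀ : ℂ, w₀.re < R → ∀ γ : C(unitInterval, ℂ), γ 0 = Complex.exp w₀ → (∀ t, γ t ∉ Ω) →
    ∃ F : unitInterval → ℂ → ℂ, IsContinuationAlong γ F ∧
      (fun w => F 0 (Complex.exp w)) =ᶠ[𝓝 w₀] φ

/-- `χ` is a major of the germ `φ`, of integrable type: `φ(ζ) = χ(ζ) - χ(e^(-2πi) ζ)`, and
`ζ χ(ζ) → 0` as `ζ → 0`, uniformly in sectors of bounded opening. -/
def IsIntegrableMajor (χ φ : ℂ → ℂ) (R : ℝ) : Prop :=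
  DifferentiableOn ℂ χ {w | w.re < R} ∧
  (∀ w : ℂ, w.re < R → φ w = χ w - χ (w - 2 * Real.pi * Complex.I)) ∧
  ∀ A ε : ℝ, 0 < ε → ∃ ρ : ℝ, ∀ w : ℂ, w.re < ρ → |w.im| ≤ A → ‖Complex.exp w * χ w‖ < ε

/-- `φ`, a function of `w = log ζ` near `ζ = 0`, is the minor of an integrable resurgent function
all of whose singularities lie over the closed discrete set `Ω` of the `ζ`-plane. -/
def IsIntegrableResurgent (φ : ℂ → ℂ) (Ω : Set ℂ) : Prop :=
  IsClosed Ω ∧ IsDiscrete Ω ∧ ∃ R : ℝ,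
    DifferentiableOn ℂ φ {w | w.re < R} ∧
    (∀ θ : ℝ, MeasureTheory.IntegrableOn
      (fun t : ℝ => φ ((Real.log t : ℂ) + (θ : ℂ) * Complex.I)) (Set.Ioo 0 (Real.exp R))) ∧
    (∃ χ : ℂ → ℂ, IsIntegrableMajor χ φ R) ∧
    ContinuableOff φ R Ω

end Resurgence

end

noncomputable section

namespace Resurgence

open Polynomial

/-! ### Coefficients of differential operators -/

/-! Holonomy is a statement about coefficients: an operator with polynomial coefficients acts as a
finite recurrence `∑ S_m(τ) c_(τ-m)` with polynomial `S_m`, and every such recurrence comes from an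
operator (`exists_recurrence_applyOp`, `exists_applyOp_recurrence`). The Borel transform divides
`c_σ` by `Γ(σ)`, and the finitely many Gamma values in one recurrence are polynomial multiples of a
single one, so the recurrence stays polynomial (`recurrence_borelTransform`). This gives (i).

For (ii), geometric growth makes the series converge absolutely in a half plane of `w = log ζ`, and
termwise differentiation shows that its sum solves the equation (`isSolutionAt_formalSum`). At a
regular point the Taylor coefficients of a solution grow at most geometrically, with a ratio that is
bounded along a compact path. Solutions thus extend to disks of one fixed radius, and finitely many
disks cover the path (`IsSolutionAt.exists_continuationAlong`). Since the exponents lie in `(1/N)ℤ`,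
the sum has monodromy of order `N`, and a weighted sum over its `N` branches is a major
(`exists_isIntegrableMajor`). The lowest possible exponent `1/N - 1 > -1` gives the estimates at the
origin. -/

lemma ofPoly_monomial (n : ℕ) (c : ℂ) : ofPoly (monomial n c) = HahnSeries.single (n : ℚ) c := by
  rw [ofPoly, aeval_monomial, HahnSeries.single_pow, HahnSeries.algebraMap_apply',
    ← PowerSeries.C_eq_algebraMap, HahnSeries.ofPowerSeries_C, HahnSeries.C_apply, HahnSeries.single_mul_single]
  simp

lemma coeff_ofPoly_mul (a : ℂ[X]) (g : HahnSeries ℚ ℂ) (τ : ℚ) :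
    (ofPoly a * g).coeff τ = a.sum fun j c => c * g.coeff (τ - j) := by
  induction a using Polynomial.induction_on' with
  | add p q hp hq =>
    have h : ofPoly (p + q) = ofPoly p + ofPoly q := map_add _ _ _
    rw [h, add_mul, HahnSeries.coeff_add, hp, hq, Polynomial.sum_add_index]
    · simp
    · intro a b c; ring
  | monomial n c =>
    rw [ofPoly_monomial, HahnSeries.coeff_single_mul, Polynomial.sum_monomial_index]
    simp

lemma coeff_iterate_formalDeriv (i : ℕ) (g : HahnSeries ℚ ℂ) (τ : ℚ) :
    (formalDeriv^[i] g).coeff τ = (ascPochhammer ℂ i).eval ((τ : ℂ) + 1) * g.coeff (τ + i) := by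
  induction i generalizing τ with
  | zero => simp
  | succ i ih =>
    rw [Function.iterate_succ_apply']
    change ((τ + 1 : ℚ) : ℂ) * (formalDeriv^[i] g).coeff (τ + 1) = _
    rw [ih, ascPochhammer_succ_left]
    have : τ + 1 + (i : ℚ) = τ + ((i + 1 : ℕ) : ℚ) := by push_cast; ring
    rw [this]
    simp [mul_assoc]

lemma applyOp_eq_sum (H : ℂ[X][X]) (g : HahnSeries ℚ ℂ) :
    applyOp H g = H.sum fun i a => ofPoly a * formalDeriv^[i] g := by
  rw [Polynomial.sum_over_range]
  · rfl
  · simp [ofPoly]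

lemma applyOp_add (H K : ℂ[X][X]) (g : HahnSeries ℚ ℂ) :
    applyOp (H + K) g = applyOp H g + applyOp K g := by
  simp only [applyOp_eq_sum]
  apply Polynomial.sum_add_index
  · simp [ofPoly]
  · simp [ofPoly, add_mul]

lemma applyOp_monomial (i : ℕ) (a : ℂ[X]) (g : HahnSeries ℚ ℂ) :
    applyOp (monomial i a) g = ofPoly a * formalDeriv^[i] g := by
  rw [applyOp_eq_sum, Polynomial.sum_monomial_index]
  simp [ofPoly]

lemma applyOp_zero (g : HahnSeries ℚ ℂ) : applyOp 0 g = 0 := by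
  simp [applyOp_eq_sum]

lemma applyOp_C_mul (p : ℂ[X]) (H : ℂ[X][X]) (g : HahnSeries ℚ ℂ) :
    applyOp (C p * H) g = ofPoly p * applyOp H g := by
  induction H using Polynomial.induction_on' with
  | add H K hH hK => rw [mul_add, applyOp_add, applyOp_add, hH, hK, mul_add]
  | monomial i a =>
    rw [C_mul_monomial, applyOp_monomial, applyOp_monomial, ← mul_assoc]
    congr 1
    exact map_mul _ _ _

/-- The Euler operator `x d/dx`. -/
def euler (g : HahnSeries ℚ ℂ) : HahnSeries ℚ ℂ := ofPoly X * formalDeriv g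

lemma coeff_euler (g : HahnSeries ℚ ℂ) (τ : ℚ) : (euler g).coeff τ = (τ : ℂ) * g.coeff τ := by
  rw [euler, coeff_ofPoly_mul, Polynomial.sum_X_index (by simp)]
  simp [formalDeriv]

lemma iterate_formalDeriv_euler (i : ℕ) (g : HahnSeries ℚ ℂ) :
    formalDeriv^[i] (euler g) =
      ofPoly X * formalDeriv^[i + 1] g + (i : HahnSeries ℚ ℂ) * formalDeriv^[i] g := by
  ext τ
  have hi : (i : HahnSeries ℚ ℂ) = ofPoly (C (i : ℂ)) := by simp [ofPoly]
  rw [hi, HahnSeries.coeff_add, coeff_ofPoly_mul, coeff_ofPoly_mul,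
    Polynomial.sum_X_index (by simp), Polynomial.sum_C_index (by simp),
    coeff_iterate_formalDeriv, coeff_iterate_formalDeriv, coeff_iterate_formalDeriv, coeff_euler,
    ascPochhammer_succ_left]
  have h : τ - ((1 : ℕ) : ℚ) + ((i + 1 : ℕ) : ℚ) = τ + i := by push_cast; ring
  rw [h]
  simp
  ring

/-- Composition with `x d/dx` on the right, from `Dⁱ x D = x Dⁱ⁺¹ + i Dⁱ`: on symbols the second
term is `X * derivative H`. -/
lemma applyOp_euler (H : ℂ[X][X]) (g : HahnSeries ℚ ℂ) :
    applyOp (C X * (X * H) + X * derivative H) g = applyOp H (euler g) := by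
  induction H using Polynomial.induction_on' with
  | add H K hH hK =>
    rw [applyOp_add H K, ← hH, ← hK, ← applyOp_add]
    congr 1
    simp only [derivative_add]
    ring
  | monomial i a =>
    rw [applyOp_add, applyOp_C_mul, X_mul_monomial, applyOp_monomial, applyOp_monomial,
      iterate_formalDeriv_euler, derivative_monomial]
    have : applyOp (X * monomial (i - 1) (a * (i : ℂ[X]))) g
        = ofPoly a * ((i : HahnSeries ℚ ℂ) * formalDeriv^[i] g) := by
      rcases i with _ | i
      · simp [applyOp_zero]
      · rw [X_mul_monomial, applyOp_monomial, ← mul_assoc]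
        simp [ofPoly]
    rw [this]
    ring

/-- The operator `S(x d/dx)` is a differential operator with polynomial coefficients. -/
lemma exists_applyOp_eval (S : ℂ[X]) : ∃ H : ℂ[X][X], ∀ (g : HahnSeries ℚ ℂ) (τ : ℚ),
    (applyOp H g).coeff τ = S.eval (τ : ℂ) * g.coeff τ := by
  induction S using Polynomial.induction_on with
  | C a =>
    refine ⟨monomial 0 (C a), fun g τ => ?_⟩
    rw [applyOp_monomial, coeff_ofPoly_mul, Polynomial.sum_C_index (by simp)]
    simp
  | add p q hp hq =>
    obtain ⟨H, hH⟩ := hp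
    obtain ⟨K, hK⟩ := hq
    refine ⟨H + K, fun g τ => ?_⟩
    rw [applyOp_add, HahnSeries.coeff_add, hH, hK, eval_add, add_mul]
  | monomial n a h =>
    obtain ⟨H, hH⟩ := h
    refine ⟨C X * (X * H) + X * derivative H, fun g τ => ?_⟩
    rw [applyOp_euler, hH, coeff_euler]
    simp [pow_succ]
    ring

/-- Every finite recurrence with polynomial coefficients comes from a differential operator. -/
lemma exists_applyOp_recurrence (M : ℕ) (S : ℕ → ℂ[X]) :
    ∃ H : ℂ[X][X], ∀ (g : HahnSeries ℚ ℂ) (τ : ℚ), (applyOp H g).coeff τ =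
      ∑ m ∈ Finset.range M, (S m).eval (τ : ℂ) * g.coeff (τ - m) := by
  induction M with
  | zero => exact ⟨0, by simp [applyOp_zero]⟩
  | succ M ih =>
    obtain ⟨H, hH⟩ := ih
    -- The factor `x^M` applied afterwards evaluates this polynomial at `τ - M`; the shift by `M`
    -- compensates.
    obtain ⟨K, hK⟩ := exists_applyOp_eval ((S M).comp (X + C (M : ℂ)))
    refine ⟨H + C (X ^ M) * K, fun g τ => ?_⟩
    rw [applyOp_add, applyOp_C_mul, HahnSeries.coeff_add, hH, Finset.sum_range_succ,
      coeff_ofPoly_mul, ← monomial_one_right_eq_X_pow, Polynomial.sum_monomial_index _ _ (by simp),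
      hK]
    simp

/-- Test on `xⁿ`: derivatives of order above `n` kill it and, by strong induction, the lower
coefficients already vanish, so only `n!` times the `n`-th coefficient remains. -/
lemma eq_zero_of_applyOp_eq_zero (H : ℂ[X][X]) (h : ∀ g, applyOp H g = 0) : H = 0 := by
  have key : ∀ n, H.coeff n = 0 := by
    intro n
    induction n using Nat.strong_induction_on with
    | _ n ih =>
      have h1 := h (HahnSeries.single (n : ℚ) 1)
      rw [applyOp_eq_sum] at h1
      have hd : ∀ (i : ℕ) (τ : ℚ), (formalDeriv^[i] (HahnSeries.single (n : ℚ) (1 : ℂ))).coeff τ =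
          if τ = (n : ℚ) - i then (ascPochhammer ℂ i).eval ((n : ℂ) - i + 1) else 0 := by
        intro i τ
        rw [coeff_iterate_formalDeriv, HahnSeries.coeff_single]
        by_cases hτ : τ = (n : ℚ) - i
        · subst hτ; simp
        · rw [if_neg hτ, if_neg (fun h => hτ (by linarith)), mul_zero]
      have hz : ∀ i, n < i → formalDeriv^[i] (HahnSeries.single (n : ℚ) (1 : ℂ)) = 0 := by
        intro i hi
        ext τ
        rw [hd]
        split_ifs with hτ
        · obtain ⟨k, rfl⟩ := Nat.exists_eq_add_of_lt hi
          have : (n : ℂ) - ((n + k + 1 : ℕ) : ℂ) + 1 = -(k : ℂ) := by push_cast; ring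
          rw [this, ascPochhammer_eval_neg_coe_nat_of_lt (by omega)]
          simp
        · rfl
      have h2 : ofPoly (H.coeff n) * formalDeriv^[n] (HahnSeries.single (n : ℚ) (1 : ℂ)) = 0 := by
        rw [← h1, Polynomial.sum]
        symm
        apply Finset.sum_eq_single n
        · intro i _ hin
          rcases lt_or_gt_of_ne hin with hi | hi
          · rw [ih i hi]; simp [ofPoly]
          · rw [hz i hi, mul_zero]
        · intro hn
          rw [notMem_support_iff.mp hn]; simp [ofPoly]
      ext j
      have h3 := congrArg (fun s => HahnSeries.coeff s (j : ℚ)) h2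
      simp only [coeff_ofPoly_mul, HahnSeries.coeff_zero, hd] at h3
      rw [Polynomial.sum, Finset.sum_eq_single j] at h3
      · simpa [Nat.factorial_ne_zero] using h3
      · intro k _ hk
        have : (j : ℚ) - k ≠ n - n := by
          rw [sub_self, sub_ne_zero]; exact_mod_cast hk.symm
        rw [if_neg this, mul_zero]
      · intro hj; rw [notMem_support_iff.mp hj, zero_mul]
  ext1 n
  simpa using key n

lemma coeff_applyOp (H : ℂ[X][X]) (D : ℕ) (hD : ∀ i, (H.coeff i).natDegree ≤ D)
    (g : HahnSeries ℚ ℂ) (τ : ℚ) : (applyOp H g).coeff τ =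
      ∑ i ∈ Finset.range (H.natDegree + 1), ∑ j ∈ Finset.range (D + 1), (H.coeff i).coeff j *
        ((ascPochhammer ℂ i).eval ((τ : ℂ) - j + 1) * g.coeff (τ - j + i)) := by
  rw [applyOp, HahnSeries.coeff_sum]
  refine Finset.sum_congr rfl fun i _ => ?_
  rw [coeff_ofPoly_mul, Polynomial.sum_over_range' _ (by simp) (D + 1) (by have := hD i; omega)]
  refine Finset.sum_congr rfl fun j _ => ?_
  rw [coeff_iterate_formalDeriv]
  simp

/-- A differential operator acts on coefficients as a finite recurrence. -/
lemma exists_recurrence_applyOp (H : ℂ[X][X]) (hH : H ≠ 0) :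
    ∃ (M : ℕ) (S : ℕ → ℂ[X]), (∃ m < M, S m ≠ 0) ∧ ∀ (g : HahnSeries ℚ ℂ) (τ : ℚ),
      (applyOp H g).coeff (τ - H.natDegree) =
        ∑ m ∈ Finset.range M, (S m).eval (τ : ℂ) * g.coeff (τ - m) := by
  set n := H.natDegree with hn
  set D := H.support.sup fun i => (H.coeff i).natDegree with hDdef
  have hD : ∀ i, (H.coeff i).natDegree ≤ D := by
    intro i
    by_cases hi : i ∈ H.support
    · exact Finset.le_sup (f := fun i => (H.coeff i).natDegree) hi
    · rw [notMem_support_iff.mp hi]; simp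
  -- The operator `xʲ Dⁱ` shifts indices by `j - i`. Reading the result at `τ - n`, with `n` the
  -- order, makes the lag `n + j - i` nonnegative, so the natural subtraction is exact.
  let S : ℕ → ℂ[X] := fun m => ∑ i ∈ Finset.range (n + 1), ∑ j ∈ Finset.range (D + 1),
    if m = n + j - i then
      C ((H.coeff i).coeff j) * (ascPochhammer ℂ i).comp (X + C (1 - (n : ℂ) - j)) else 0
  have hS : ∀ (g : HahnSeries ℚ ℂ) (τ : ℚ), (applyOp H g).coeff (τ - n) =
      ∑ m ∈ Finset.range (n + D + 1), (S m).eval (τ : ℂ) * g.coeff (τ - m) := by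
    intro g τ
    rw [coeff_applyOp H D hD]
    simp only [S, eval_finsetSum, Finset.sum_mul]
    conv_rhs => rw [Finset.sum_comm]
    refine Finset.sum_congr rfl fun i hi => ?_
    rw [Finset.sum_comm]
    refine Finset.sum_congr rfl fun j hj => ?_
    rw [Finset.mem_range] at hi hj
    rw [Finset.sum_eq_single (n + j - i)]
    · rw [if_pos rfl]
      have h1 : τ - n - j + i = τ - ((n + j - i : ℕ) : ℚ) := by
        rw [Nat.cast_sub (by omega)]; push_cast; ring
      have h2 : ((τ - n : ℚ) : ℂ) - j + 1 = τ + (1 - n - j) := by push_cast; ring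
      rw [h1, h2]
      simp [mul_assoc]
    · intro m _ hm; simp [hm]
    · intro hm; exact absurd (Finset.mem_range.mpr (by omega)) hm
  refine ⟨n + D + 1, S, ?_, hS⟩
  by_contra! hcon
  refine hH (eq_zero_of_applyOp_eq_zero H fun g => ?_)
  ext τ
  have := hS g (τ + n)
  rw [add_sub_cancel_right] at this
  rw [this, HahnSeries.coeff_zero]
  refine Finset.sum_eq_zero fun m hm => ?_
  rw [hcon m (Finset.mem_range.mp hm)]
  simp

/-! ### The Borel transform of a holonomic series -/

lemma Gamma_add_natCast (u : ℂ) (hu : ∀ m : ℕ, u ≠ -m) (k : ℕ) :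
    Complex.Gamma (u + k) = (ascPochhammer ℂ k).eval u * Complex.Gamma u := by
  induction k with
  | zero => simp
  | succ k ih =>
    have : u + k ≠ 0 := fun h => hu k (eq_neg_of_add_eq_zero_left h)
    rw [Nat.cast_succ, ← add_assoc, Complex.Gamma_add_one _ this, ih, ascPochhammer_succ_eval]
    ring

lemma eq_zero_of_eval_ratCast (p : ℂ[X]) (h : ∀ σ : ℚ, p.eval (σ : ℂ) = 0) : p = 0 := by
  refine Polynomial.eq_zero_of_infinite_isRoot p ?_
  refine Set.Infinite.mono ?_ (Set.infinite_range_of_injective (Rat.cast_injective (α := ℂ)))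
  rintro _ ⟨σ, rfl⟩
  exact h σ

/-- With `u = τ + 1 - M`, one has `Γ(τ - m + 1) = (u)_(M-m) Γ(u)` in rising factorials, so `Γ(u)` is
a common factor of the recurrence at `τ + 1`. The extra factor `(u)_M` deals with poles of `Γ(u)`.
-/
lemma recurrence_borelTransform (f : HahnSeries ℚ ℂ) (hpos : ∀ σ : ℚ, σ ≤ 0 → f.coeff σ = 0)
    (M : ℕ) (S : ℕ → ℂ[X])
    (hS : ∀ τ : ℚ, ∑ m ∈ Finset.range M, (S m).eval (τ : ℂ) * f.coeff (τ - m) = 0) (τ : ℚ) :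
    ∑ m ∈ Finset.range M, (ascPochhammer ℂ M).eval ((τ : ℂ) + 1 - M) *
      ((ascPochhammer ℂ (M - m)).eval ((τ : ℂ) + 1 - M) * (S m).eval ((τ : ℂ) + 1)) *
        (borelTransform f).coeff (τ - m) = 0 := by
  by_cases hτ : ∀ k : ℕ, (τ : ℂ) + 1 - M ≠ -k
  · have hG := Complex.Gamma_ne_zero hτ
    have h := hS (τ + 1)
    rw [← mul_right_inj' hG, mul_zero]
    rw [Finset.mul_sum]
    have key : ∀ m ∈ Finset.range M, Complex.Gamma ((τ : ℂ) + 1 - M) *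
        ((ascPochhammer ℂ M).eval ((τ : ℂ) + 1 - M) *
      ((ascPochhammer ℂ (M - m)).eval ((τ : ℂ) + 1 - M) * (S m).eval ((τ : ℂ) + 1)) *
        (borelTransform f).coeff (τ - m)) = (ascPochhammer ℂ M).eval ((τ : ℂ) + 1 - M) *
        ((S m).eval (((τ + 1 : ℚ) : ℂ)) * f.coeff (τ + 1 - m)) := by
      intro m hm
      have hmM : m < M := Finset.mem_range.mp hm
      have h1 := Gamma_add_natCast _ hτ (M - m)
      have h2 : (τ : ℂ) + 1 - M + ((M - m : ℕ) : ℂ) = ((τ - m + 1 : ℚ) : ℂ) := by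
        rw [Nat.cast_sub hmM.le]; push_cast; ring
      have h3 : Complex.Gamma ((τ - m + 1 : ℚ) : ℂ) ≠ 0 := by
        refine Complex.Gamma_ne_zero fun k hk => hτ (k + (M - m)) ?_
        rw [← h2] at hk
        push_cast
        linear_combination hk
      have h4 : (borelTransform f).coeff (τ - m) =
          (Complex.Gamma ((τ - m + 1 : ℚ) : ℂ))⁻¹ * f.coeff (τ - m + 1) := rfl
      have h5 : τ - m + 1 = τ + 1 - (m : ℚ) := by ring
      rw [h2] at h1
      rw [h4]
      calc _ = (ascPochhammer ℂ M).eval ((τ : ℂ) + 1 - M) * ((S m).eval ((τ : ℂ) + 1) *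
            (((ascPochhammer ℂ (M - m)).eval ((τ : ℂ) + 1 - M) * Complex.Gamma ((τ : ℂ) + 1 - M)) *
            (Complex.Gamma ((τ - m + 1 : ℚ) : ℂ))⁻¹ * f.coeff (τ - m + 1))) := by ring
        _ = _ := by rw [← h1, mul_inv_cancel₀ h3, one_mul, h5]; push_cast; rfl
    rw [Finset.sum_congr rfl key, ← Finset.mul_sum, hS, mul_zero]
  -- Here `u = -k` is a pole. If `k < M`, the factor `(u)_M` vanishes; otherwise `τ - m + 1 ≤ 0` for
  -- all `m`, and the coefficients of `f` vanish.
  · push Not at hτ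
    obtain ⟨k, hk⟩ := hτ
    by_cases hkM : k < M
    · rw [hk, ascPochhammer_eval_neg_coe_nat_of_lt hkM]
      simp
    · refine Finset.sum_eq_zero fun m _ => ?_
      have h1 : τ + 1 - M = -(k : ℚ) := by exact_mod_cast hk
      have h2 : f.coeff (τ - m + 1) = 0 := by
        apply hpos
        have h3 : (M : ℚ) ≤ k := by exact_mod_cast not_lt.mp hkM
        have h4 : (0 : ℚ) ≤ m := by positivity
        linarith
      change _ * ((Complex.Gamma ((τ - m + 1 : ℚ) : ℂ))⁻¹ * f.coeff (τ - m + 1)) = 0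
      rw [h2]; simp

theorem isHolonomic_borelTransform (f : HahnSeries ℚ ℂ)
    (hpos : ∀ σ : ℚ, σ ≤ 0 → f.coeff σ = 0) (hol : IsHolonomic f) :
    IsHolonomic (borelTransform f) := by
  obtain ⟨H, hH, hHf⟩ := hol
  obtain ⟨M, S, ⟨m, hmM, hm⟩, hS⟩ := exists_recurrence_applyOp H hH
  let u : ℂ[X] := X + C (1 - (M : ℂ))
  let S' : ℕ → ℂ[X] := fun m => (ascPochhammer ℂ M).comp u *
    ((ascPochhammer ℂ (M - m)).comp u * (S m).comp (X + C 1))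
  obtain ⟨K, hK⟩ := exists_applyOp_recurrence M S'
  refine ⟨K, ?_, ?_⟩
  · rintro rfl
    have hne : S' m ≠ 0 := by
      have h0 : ∀ (p : ℂ[X]) (a : ℂ), p ≠ 0 → p.comp (X + C a) ≠ 0 := by
        intro p a hp h
        exact hp ((Polynomial.comp_X_add_C_eq_zero_iff).mp h)
      have hasc : ∀ k, ascPochhammer ℂ k ≠ 0 := fun k => (monic_ascPochhammer ℂ k).ne_zero
      exact mul_ne_zero (h0 _ _ (hasc _)) (mul_ne_zero (h0 _ _ (hasc _)) (h0 _ _ hm))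
    refine hne (eq_zero_of_eval_ratCast _ fun σ => ?_)
    -- This monomial isolates the `m`-th term of the recurrence at `σ`.
    have h := hK (HahnSeries.single (σ - m) 1) σ
    rw [applyOp_zero, HahnSeries.coeff_zero, Finset.sum_eq_single m] at h
    · simpa using h.symm
    · intro k _ hk
      rw [HahnSeries.coeff_single_of_ne, mul_zero]
      intro he
      apply hk
      have : (k : ℚ) = m := by linarith
      exact_mod_cast this
    · intro hm'; exact absurd (Finset.mem_range.mpr hmM) hm'
  · ext τ
    rw [hK, HahnSeries.coeff_zero]
    refine Eq.trans (Finset.sum_congr rfl fun k _ => ?_)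
      (recurrence_borelTransform f hpos M S (fun τ => ?_) τ)
    · simp [S', u, add_sub_assoc]
    · rw [← hS, hHf, HahnSeries.coeff_zero]

/-! ### Analytic solutions of linear differential equations with polynomial coefficients -/

/-- The action of a differential operator with polynomial coefficients on functions. -/
def diffOp (H : ℂ[X][X]) (y : ℂ → ℂ) (z : ℂ) : ℂ :=
  ∑ i ∈ Finset.range (H.natDegree + 1), (H.coeff i).eval z * deriv^[i] y z

/-- `y` is an analytic solution of `H(y) = 0` near `z₀`. -/
def IsSolutionAt (H : ℂ[X][X]) (y : ℂ → ℂ) (z₀ : ℂ) : Prop :=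
  AnalyticAt ℂ y z₀ ∧ ∀ᶠ z in 𝓝 z₀, diffOp H y z = 0

lemma eventuallyEq_iterate_deriv {y₁ y₂ : ℂ → ℂ} {z : ℂ} (h : y₁ =ᶠ[𝓝 z] y₂) (i : ℕ) :
    deriv^[i] y₁ =ᶠ[𝓝 z] deriv^[i] y₂ := by
  induction i with
  | zero => exact h
  | succ i ih =>
    rw [Function.iterate_succ_apply', Function.iterate_succ_apply']
    exact ih.deriv

lemma eventuallyEq_diffOp (H : ℂ[X][X]) {y₁ y₂ : ℂ → ℂ} {z : ℂ} (h : y₁ =ᶠ[𝓝 z] y₂) :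
    diffOp H y₁ =ᶠ[𝓝 z] diffOp H y₂ := by
  have := fun i => eventuallyEq_iterate_deriv h i
  have h2 : ∀ᶠ w in 𝓝 z, ∀ i ∈ Finset.range (H.natDegree + 1),
      deriv^[i] y₁ w = deriv^[i] y₂ w :=
    (Finset.eventually_all _).mpr fun i _ => this i
  filter_upwards [h2] with w hw
  exact Finset.sum_congr rfl fun i hi => by rw [hw i hi]

lemma IsSolutionAt.congr {H : ℂ[X][X]} {y₁ y₂ : ℂ → ℂ} {z : ℂ} (h₁ : IsSolutionAt H y₁ z)
    (h : y₁ =ᶠ[𝓝 z] y₂) : IsSolutionAt H y₂ z :=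
  ⟨h₁.1.congr h, by
    filter_upwards [h₁.2, eventuallyEq_diffOp H h] with w hw hw'
    rw [← hw', hw]⟩

lemma analyticAt_iterate_deriv {y : ℂ → ℂ} {z : ℂ} (h : AnalyticAt ℂ y z) (i : ℕ) :
    AnalyticAt ℂ (deriv^[i] y) z := by
  induction i with
  | zero => exact h
  | succ i ih => rw [Function.iterate_succ_apply']; exact ih.deriv

lemma analyticAt_eval (p : ℂ[X]) (z : ℂ) : AnalyticAt ℂ (fun w => p.eval w) z :=
  p.differentiable.analyticAt z

lemma analyticAt_diffOp (H : ℂ[X][X]) {y : ℂ → ℂ} {z : ℂ} (h : AnalyticAt ℂ y z) :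
    AnalyticAt ℂ (diffOp H y) z :=
  Finset.analyticAt_fun_sum _ fun i _ => (analyticAt_eval _ z).mul (analyticAt_iterate_deriv h i)

lemma iterate_deriv_eval (p : ℂ[X]) (j : ℕ) (z : ℂ) :
    iteratedDeriv j (fun w => p.eval w) z = (j.factorial : ℂ) * (hasseDeriv j p).eval z := by
  have h : ∀ j, iteratedDeriv j (fun w => p.eval w) = fun w => (derivative^[j] p).eval w := by
    intro j
    induction j with
    | zero => simp
    | succ j ih =>
      rw [iteratedDeriv_succ, ih, Function.iterate_succ_apply']
      ext w
      exact Polynomial.deriv _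
  rw [h, ← factorial_smul_hasseDeriv]
  simp [nsmul_eq_mul]

/-- The recurrence satisfied by the derivatives of a solution at a point. -/
lemma IsSolutionAt.recurrence {H : ℂ[X][X]} {y : ℂ → ℂ} {z₀ : ℂ} (h : IsSolutionAt H y z₀)
    (k : ℕ) : ∑ i ∈ Finset.range (H.natDegree + 1), ∑ j ∈ Finset.range (k + 1),
      (k.choose j : ℂ) * ((j.factorial : ℂ) * (hasseDeriv j (H.coeff i)).eval z₀) *
        deriv^[k - j + i] y z₀ = 0 := by
  have h0 : iteratedDeriv k (diffOp H y) z₀ = 0 := by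
    have : diffOp H y =ᶠ[𝓝 z₀] fun _ => 0 := h.2
    rw [iteratedDeriv_eq_iterate, (eventuallyEq_iterate_deriv this k).eq_of_nhds,
      ← iteratedDeriv_eq_iterate, iteratedDeriv_fun_const_zero]
  rw [← h0]
  unfold diffOp
  rw [iteratedDeriv_fun_sum (f := fun i z => (H.coeff i).eval z * deriv^[i] y z) fun i _ =>
    ((analyticAt_eval _ z₀).mul (analyticAt_iterate_deriv h.1 i)).contDiffAt]
  refine Finset.sum_congr rfl fun i _ => ?_
  rw [iteratedDeriv_fun_mul (analyticAt_eval _ z₀).contDiffAt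
    (analyticAt_iterate_deriv h.1 i).contDiffAt]
  refine Finset.sum_congr rfl fun j _ => ?_
  rw [iterate_deriv_eval, iteratedDeriv_eq_iterate, Function.iterate_add_apply]

/-- Controls the factorial weights of the recurrence for Taylor coefficients, so that its bound does
not depend on `k`. -/
lemma choose_mul_factorial_le {i j k n : ℕ} (hi : i ≤ n) (hj : j ≤ k) :
    k.choose j * j.factorial * (k - j + i).factorial ≤ (n + k).factorial := by
  have h1 : (k - j + i).factorial = (k - j).factorial * (k - j + 1).ascFactorial i :=
    (Nat.factorial_mul_ascFactorial _ _).symm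
  have h2 : (k - j + 1).ascFactorial i ≤ (k + 1).ascFactorial i :=
    Nat.ascFactorial_le i (by omega)
  calc k.choose j * j.factorial * (k - j + i).factorial
      = (k.choose j * j.factorial * (k - j).factorial) * (k - j + 1).ascFactorial i := by
        rw [h1]; ring
    _ = k.factorial * (k - j + 1).ascFactorial i := by rw [Nat.choose_mul_factorial_mul_factorial hj]
    _ ≤ k.factorial * (k + 1).ascFactorial i := Nat.mul_le_mul_left _ h2
    _ = (k + i).factorial := Nat.factorial_mul_ascFactorial _ _
    _ ≤ _ := Nat.factorial_le (by omega)

/-- Since `K ≥ 1`, the bounds `C₀ K^m` increase, so the last one dominates all earlier terms and one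
step costs one factor `K`. -/
lemma exists_geometric_bound (c : ℕ → ℂ) (n : ℕ) {K : ℝ} (hK : 1 ≤ K)
    (h : ∀ k C, 0 ≤ C → (∀ m < n + k, ‖c m‖ ≤ C) → ‖c (n + k)‖ ≤ K * C) :
    ∃ C, ∀ m, ‖c m‖ ≤ C * K ^ m := by
  set C₀ := ∑ m ∈ Finset.range n, ‖c m‖ with hC₀
  have hC : 0 ≤ C₀ := Finset.sum_nonneg fun _ _ => norm_nonneg _
  refine ⟨C₀, fun m => ?_⟩
  induction m using Nat.strong_induction_on with
  | _ m ih =>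
    rcases lt_or_ge m n with hm | hm
    · calc ‖c m‖ ≤ C₀ := Finset.single_le_sum (f := fun m => ‖c m‖) (fun _ _ => norm_nonneg _)
            (Finset.mem_range.mpr hm)
        _ ≤ C₀ * K ^ m := le_mul_of_one_le_right hC (one_le_pow₀ hK)
    · obtain ⟨k, rfl⟩ := Nat.exists_eq_add_of_le hm
      -- With no earlier term, `h` applies with bound `0`.
      rcases Nat.eq_zero_or_pos (n + k) with h0 | h0
      · have := h k 0 le_rfl (fun m hm => by omega)
        rw [mul_zero] at this
        exact this.trans (by positivity)
      · have := h k (C₀ * K ^ (n + k - 1)) (by positivity) fun m hm =>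
          (ih m hm).trans (by gcongr; omega)
        calc ‖c (n + k)‖ ≤ K * (C₀ * K ^ (n + k - 1)) := this
          _ = C₀ * K ^ (n + k - 1 + 1) := by ring
          _ = C₀ * K ^ (n + k) := by rw [Nat.sub_add_cancel h0]

/-- The sum of the absolute values of the Taylor coefficients of the coefficients of `H`. -/
def coeffNorm (H : ℂ[X][X]) (z : ℂ) : ℝ :=
  ∑ i ∈ Finset.range (H.natDegree + 1), ∑ j ∈ Finset.range ((H.coeff i).natDegree + 1),
    ‖(hasseDeriv j (H.coeff i)).eval z‖

lemma continuous_coeffNorm (H : ℂ[X][X]) : Continuous (coeffNorm H) := by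
  unfold coeffNorm
  fun_prop

lemma sum_norm_le_coeffNorm (H : ℂ[X][X]) (z : ℂ) (k : ℕ) :
    ∑ i ∈ Finset.range (H.natDegree + 1), ∑ j ∈ Finset.range (k + 1),
      ‖(hasseDeriv j (H.coeff i)).eval z‖ ≤ coeffNorm H z := by
  refine Finset.sum_le_sum fun i _ => ?_
  set d := (H.coeff i).natDegree + 1 with hd
  calc _ ≤ ∑ j ∈ Finset.range (max (k + 1) d), ‖(hasseDeriv j (H.coeff i)).eval z‖ :=
        Finset.sum_le_sum_of_subset_of_nonneg (Finset.range_mono (le_max_left _ _))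
          fun _ _ _ => norm_nonneg _
    _ = _ := by
      refine (Finset.sum_subset (Finset.range_mono (le_max_right _ _)) fun j _ hj => ?_).symm
      rw [Finset.mem_range] at hj
      rw [hasseDeriv_eq_zero_of_lt_natDegree _ _ (by omega)]
      simp

/-- The term `(i, j) = (n, 0)` of the `k`-th recurrence is the only one with a derivative of order
`n + k`. Solving for it divides by the leading coefficient at `z₀`; the remaining terms contribute
at most `coeffNorm H z₀` times the largest earlier Taylor coefficient. -/
lemma IsSolutionAt.taylor_bound {H : ℂ[X][X]} {y : ℂ → ℂ} {z₀ : ℂ} (h : IsSolutionAt H y z₀)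
    (hz₀ : H.leadingCoeff.eval z₀ ≠ 0) {K : ℝ} (hK1 : 1 ≤ K)
    (hK : coeffNorm H z₀ ≤ K * ‖H.leadingCoeff.eval z₀‖) :
    ∃ C, ∀ m, ‖iteratedDeriv m y z₀ / m.factorial‖ ≤ C * K ^ m := by
  refine exists_geometric_bound _ H.natDegree hK1 fun k C hC hm => ?_
  set n := H.natDegree with hn
  set c : ℕ → ℂ := fun m => iteratedDeriv m y z₀ / m.factorial with hc
  have hfac : ∀ m : ℕ, (m.factorial : ℂ) ≠ 0 := fun m => by exact_mod_cast m.factorial_ne_zero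
  have hd : ∀ m, deriv^[m] y z₀ = m.factorial * c m := fun m => by
    rw [hc, ← iteratedDeriv_eq_iterate]; field_simp [hfac m]
  let T : ℕ × ℕ → ℂ := fun q => (k.choose q.2 : ℂ) *
    ((q.2.factorial : ℂ) * (hasseDeriv q.2 (H.coeff q.1)).eval z₀) * deriv^[k - q.2 + q.1] y z₀
  let s := Finset.range (n + 1) ×ˢ Finset.range (k + 1)
  have hs : (n, 0) ∈ s := by simp [s]
  have hsum : ∑ q ∈ s, T q = 0 := by
    rw [Finset.sum_product]; exact h.recurrence k
  have hT0 : T (n, 0) = H.leadingCoeff.eval z₀ * ((n + k).factorial * c (n + k)) := by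
    simp only [T, Nat.choose_zero_right, Nat.factorial_zero, hasseDeriv_zero', Nat.sub_zero,
      hd, Nat.add_comm k n]
    simp [n]
  have hT : ∀ q ∈ s.erase (n, 0),
      ‖T q‖ ≤ (n + k).factorial * (‖(hasseDeriv q.2 (H.coeff q.1)).eval z₀‖ * C) := by
    rintro ⟨i, j⟩ hq
    simp only [s, Finset.mem_erase, Finset.mem_product, Finset.mem_range, ne_eq,
      Prod.mk.injEq] at hq
    obtain ⟨hne, hi, hj⟩ := hq
    have hlt : k - j + i < n + k := by
      rcases Nat.eq_zero_or_pos j with rfl | hj0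
      · have : i ≠ n := fun h => hne ⟨h, rfl⟩
        omega
      · omega
    have h1 := choose_mul_factorial_le (i := i) (j := j) (k := k) (n := n) (by omega) (by omega)
    have h2 : (k.choose j * j.factorial * (k - j + i).factorial : ℝ) ≤ (n + k).factorial := by
      exact_mod_cast h1
    have h3 := hm _ hlt
    simp only [T, hd, norm_mul, Complex.norm_natCast]
    calc _ = ((k.choose j : ℝ) * j.factorial * (k - j + i).factorial) *
          (‖(hasseDeriv j (H.coeff i)).eval z₀‖ * ‖c (k - j + i)‖) := by ring
      _ ≤ _ := by gcongr
  have h4 : T (n, 0) = -∑ q ∈ s.erase (n, 0), T q := by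
    rw [← Finset.add_sum_erase s T hs] at hsum
    exact eq_neg_of_add_eq_zero_left hsum
  have h5 : ‖T (n, 0)‖ ≤ (n + k).factorial * (coeffNorm H z₀ * C) := by
    rw [h4, norm_neg]
    calc _ ≤ ∑ q ∈ s.erase (n, 0), ‖T q‖ := norm_sum_le _ _
      _ ≤ ∑ q ∈ s.erase (n, 0),
          (n + k).factorial * (‖(hasseDeriv q.2 (H.coeff q.1)).eval z₀‖ * C) :=
        Finset.sum_le_sum hT
      _ ≤ ∑ q ∈ s, (n + k).factorial * (‖(hasseDeriv q.2 (H.coeff q.1)).eval z₀‖ * C) :=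
        Finset.sum_le_sum_of_subset_of_nonneg (Finset.erase_subset _ _) fun _ _ _ => by positivity
      _ = (n + k).factorial * ((∑ q ∈ s, ‖(hasseDeriv q.2 (H.coeff q.1)).eval z₀‖) * C) := by
        rw [Finset.sum_mul, Finset.mul_sum]
      _ ≤ _ := by
        gcongr
        rw [Finset.sum_product]
        exact sum_norm_le_coeffNorm H z₀ k
  rw [hT0, norm_mul, norm_mul, Complex.norm_natCast] at h5
  have hf : (0 : ℝ) < (n + k).factorial := by exact_mod_cast Nat.factorial_pos _
  have ha : 0 < ‖H.leadingCoeff.eval z₀‖ := norm_pos_iff.mpr hz₀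
  have h6 : ((n + k).factorial * ‖H.leadingCoeff.eval z₀‖) * ‖c (n + k)‖ ≤
      ((n + k).factorial * ‖H.leadingCoeff.eval z₀‖) * (K * C) := by
    calc _ = ‖H.leadingCoeff.eval z₀‖ * ((n + k).factorial * ‖c (n + k)‖) := by ring
      _ ≤ (n + k).factorial * (coeffNorm H z₀ * C) := h5
      _ ≤ (n + k).factorial * ((K * ‖H.leadingCoeff.eval z₀‖) * C) := by gcongr
      _ = _ := by ring
  exact le_of_mul_le_mul_left h6 (by positivity)

/-- A solution germ at a regular point extends to a solution on a disk of explicit radius. -/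
theorem IsSolutionAt.exists_extension {H : ℂ[X][X]} {y : ℂ → ℂ} {z₀ : ℂ}
    (h : IsSolutionAt H y z₀) (hz₀ : H.leadingCoeff.eval z₀ ≠ 0) {K : ℝ} (hK1 : 1 ≤ K)
    (hK : coeffNorm H z₀ ≤ K * ‖H.leadingCoeff.eval z₀‖) :
    ∃ Y : ℂ → ℂ, (∀ z ∈ Metric.ball z₀ K⁻¹, IsSolutionAt H Y z) ∧ Y =ᶠ[𝓝 z₀] y := by
  obtain ⟨C, hC⟩ := h.taylor_bound hz₀ hK1 hK
  have hKpos : 0 < K := by linarith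
  set p := FormalMultilinearSeries.ofScalars ℂ (fun m => iteratedDeriv m y z₀ / m.factorial)
    with hp
  have hrad : ENNReal.ofReal K⁻¹ ≤ p.radius := by
    refine p.le_radius_of_bound C fun m => ?_
    rw [hp, FormalMultilinearSeries.ofScalars_norm, Real.coe_toNNReal _ (by positivity)]
    calc _ ≤ C * K ^ m * K⁻¹ ^ m := by gcongr; exact hC m
      _ = C := by rw [mul_assoc, ← mul_pow, mul_inv_cancel₀ hKpos.ne', one_pow, mul_one]
  have hpos : 0 < p.radius := lt_of_lt_of_le (by simpa using hKpos) hrad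
  have hyp : HasFPowerSeriesAt y p z₀ := h.1.hasFPowerSeriesAt
  let Y : ℂ → ℂ := fun z => p.sum (z - z₀)
  have hY : HasFPowerSeriesOnBall Y p z₀ p.radius := by
    simpa using (p.hasFPowerSeriesOnBall hpos).comp_sub z₀
  have hYan : AnalyticOnNhd ℂ Y (Metric.ball z₀ K⁻¹) := by
    rw [← Metric.eball_ofReal]
    exact hY.analyticOnNhd.mono (Metric.eball_subset_eball hrad)
  have hYy : Y =ᶠ[𝓝 z₀] y := by
    filter_upwards [hY.hasFPowerSeriesAt.eventually_hasSum_sub, hyp.eventually_hasSum_sub]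
      with z h1 h2
    exact h1.unique h2
  refine ⟨Y, fun z hz => ⟨hYan z hz, ?_⟩, hYy⟩
  have hL : AnalyticOnNhd ℂ (diffOp H Y) (Metric.ball z₀ K⁻¹) := fun w hw =>
    analyticAt_diffOp H (hYan w hw)
  have h0 : diffOp H Y =ᶠ[𝓝 z₀] 0 := by
    filter_upwards [eventuallyEq_diffOp H hYy, h.2] with w h1 h2
    rw [h1, h2]; rfl
  -- The identity theorem carries the equation from the centre to the whole disk.
  have heq := hL.eqOn_zero_of_preconnected_of_eventuallyEq_zero
    (convex_ball z₀ K⁻¹).isPreconnected (Metric.mem_ball_self (by positivity)) h0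
  filter_upwards [Metric.isOpen_ball.mem_nhds hz] with w hw using heq hw

lemma exists_uniform_bound (H : ℂ[X][X]) (γ : C(unitInterval, ℂ))
    (hγ : ∀ t, γ t ∉ singularPoints H) :
    ∃ K : ℝ, 1 ≤ K ∧ ∀ t, coeffNorm H (γ t) ≤ K * ‖H.leadingCoeff.eval (γ t)‖ := by
  have hpos : ∀ t, 0 < ‖H.leadingCoeff.eval (γ t)‖ := fun t => norm_pos_iff.mpr (hγ t)
  have hcont : Continuous fun t => coeffNorm H (γ t) / ‖H.leadingCoeff.eval (γ t)‖ :=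
    ((continuous_coeffNorm H).comp γ.continuous).div (by fun_prop) fun t => (hpos t).ne'
  obtain ⟨K, hK⟩ := (isCompact_range hcont).bddAbove
  refine ⟨max 1 K, le_max_left _ _, fun t => ?_⟩
  rw [← div_le_iff₀ (hpos t)]
  exact (hK ⟨t, rfl⟩).trans (le_max_right _ _)

/-- Solutions can be continued analytically along every path avoiding the singular points. -/
theorem IsSolutionAt.exists_continuationAlong {H : ℂ[X][X]} (γ : C(unitInterval, ℂ))
    (hγ : ∀ t, γ t ∉ singularPoints H) {y : ℂ → ℂ} (hy : IsSolutionAt H y (γ 0)) :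
    ∃ F : unitInterval → ℂ → ℂ, IsContinuationAlong γ F ∧ F 0 =ᶠ[𝓝 (γ 0)] y := by
  obtain ⟨K, hK1, hK⟩ := exists_uniform_bound H γ hγ
  have hKpos : (0 : ℝ) < K⁻¹ := inv_pos.mpr (by linarith)
  -- Extension is made total, with a default value off solutions, so that it can be iterated before
  -- the iterates are known to be solutions.
  have hext : ∀ (t : unitInterval) (y : ℂ → ℂ), ∃ Y : ℂ → ℂ, IsSolutionAt H y (γ t) →
      (∀ z ∈ Metric.ball (γ t) K⁻¹, IsSolutionAt H Y z) ∧ Y =ᶠ[𝓝 (γ t)] y := by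
    intro t y
    by_cases h : IsSolutionAt H y (γ t)
    · obtain ⟨Y, hY⟩ := h.exists_extension (hγ t) hK1 (hK t)
      exact ⟨Y, fun _ => hY⟩
    · exact ⟨y, fun h' => absurd h' h⟩
  choose E hE using hext
  obtain ⟨δ, hδ, hunif⟩ := Metric.uniformContinuous_iff.mp
    (CompactSpace.uniformContinuous_of_continuous γ.continuous) K⁻¹ hKpos
  set η := δ / 2 with hη
  have hηpos : 0 < η := by positivity
  -- Grid of mesh `η`, clamped at `1`; consecutive images under `γ` are less than `K⁻¹` apart, so
  -- each point lies in the preceding disk.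
  let τ : ℕ → unitInterval := fun n => Set.projIcc 0 1 zero_le_one (n * η)
  have hτdist : ∀ n, dist (τ (n + 1)) (τ n) < δ := by
    intro n
    have h1 : |(τ (n + 1) : ℝ) - τ n| ≤ |((n + 1 : ℕ) : ℝ) * η - n * η| :=
      Set.abs_projIcc_sub_projIcc zero_le_one
    have h2 : ((n + 1 : ℕ) : ℝ) * η - n * η = η := by push_cast; ring
    rw [h2, abs_of_pos hηpos] at h1
    rw [Subtype.dist_eq, Real.dist_eq]
    linarith
  have hτ0 : τ 0 = 0 := by simp [τ]
  let Y : ℕ → ℂ → ℂ := fun n => Nat.rec (E 0 y) (fun n Yn => E (τ (n + 1)) Yn) n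
  have hsol : ∀ n, ∀ z ∈ Metric.ball (γ (τ n)) K⁻¹, IsSolutionAt H (Y n) z := by
    intro n
    induction n with
    | zero => rw [hτ0]; exact (hE 0 y hy).1
    | succ n ih => exact (hE _ _ (ih _ (hunif (hτdist n)))).1
  have hglue : ∀ n, Y (n + 1) =ᶠ[𝓝 (γ (τ (n + 1)))] Y n := fun n =>
    (hE _ _ (hsol n _ (hunif (hτdist n)))).2
  let u : unitInterval → ℕ := fun t => ⌊(t : ℝ) / η⌋₊
  have hu1 : ∀ t : unitInterval, (u t : ℝ) * η ≤ t := fun t =>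
    (le_div_iff₀ hηpos).mp (Nat.floor_le (div_nonneg t.2.1 hηpos.le))
  have hu2 : ∀ t : unitInterval, (t : ℝ) < (u t + 1) * η := fun t =>
    (div_lt_iff₀ hηpos).mp (Nat.lt_floor_add_one _)
  have hlt : ∀ (m : ℕ) (t : unitInterval), (t : ℝ) < m * η → u t < m := by
    intro m t h
    have : (u t : ℝ) * η < m * η := (hu1 t).trans_lt h
    exact_mod_cast lt_of_mul_lt_mul_right this hηpos.le
  have hle : ∀ (m : ℕ) (t : unitInterval), (m : ℝ) * η ≤ t → m ≤ u t := fun m t h =>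
    Nat.le_floor ((le_div_iff₀ hηpos).mpr h)
  have hτu : ∀ t, (τ (u t) : ℝ) = u t * η := by
    intro t
    have : (u t : ℝ) * η ∈ Set.Icc (0 : ℝ) 1 := ⟨by positivity, (hu1 t).trans t.2.2⟩
    simp only [τ]
    rw [Set.projIcc_of_mem _ this]
  have hdist : ∀ t, γ t ∈ Metric.ball (γ (τ (u t))) K⁻¹ := by
    intro t
    apply hunif
    rw [Subtype.dist_eq, Real.dist_eq, hτu, abs_of_nonneg (sub_nonneg.mpr (hu1 t))]
    have := hu2 t
    linarith
  refine ⟨fun t => Y (u t), ⟨fun t => (hsol _ _ (hdist t)).1, fun t => ?_⟩, ?_⟩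
  · have hc : Continuous fun s : unitInterval => (s : ℝ) := continuous_subtype_val
    have hup : ∀ᶠ s : unitInterval in 𝓝 t, (s : ℝ) < (u t + 1 : ℕ) * η :=
      hc.continuousAt.eventually_lt_const (by have := hu2 t; push_cast; exact this)
    rcases (hu1 t).lt_or_eq with hgt | heq
    -- Strictly between grid points `u` is locally constant; at a positive grid point it can drop by
    -- one, and `hglue` identifies the two germs.
    · have hlow : ∀ᶠ s : unitInterval in 𝓝 t, (u t : ℝ) * η < s :=
        hc.continuousAt.eventually_const_lt hgt
      filter_upwards [hup, hlow] with s h1 h2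
      have : u s = u t := le_antisymm (Nat.lt_succ_iff.mp (hlt _ _ h1)) (hle _ _ h2.le)
      simp only [this]
      rfl
    · have ht : τ (u t) = t := Subtype.ext ((hτu t).trans heq)
      rcases Nat.eq_zero_or_pos (u t) with h0 | h0
      · filter_upwards [hup] with s h1
        have : u s = u t := by have := hlt _ _ h1; omega
        simp only [this]
        rfl
      · obtain ⟨n, hn⟩ : ∃ n, u t = n + 1 := ⟨u t - 1, by omega⟩
        have hlow : ∀ᶠ s : unitInterval in 𝓝 t, (n : ℝ) * η < s := by
          apply hc.continuousAt.eventually_const_lt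
          change (n : ℝ) * η < t
          rw [← heq, hn]
          push_cast
          linarith
        have hg := hglue n
        rw [← hn, ht] at hg
        have hg' := γ.continuous.continuousAt.eventually hg.eventuallyEq_nhds
        filter_upwards [hup, hlow, hg'] with s h1 h2 h3
        have h4 := hlt _ _ h1
        have h5 := hle _ _ h2.le
        rcases (by omega : u s = u t ∨ u s = n) with h6 | h6
        · simp only [h6]; rfl
        · simp only [h6]; exact h3.symm
  · have : u 0 = 0 := by simp [u]
    simp only [this]
    exact (hE 0 y hy).2

/-! ### Sums of formal series -/

lemma norm_term (g : HahnSeries ℚ ℂ) (w : ℂ) (τ : ℚ) :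
    ‖term g w τ‖ = ‖g.coeff τ‖ * Real.exp (τ * w.re) := by
  rw [term, norm_mul, Complex.norm_exp]
  have : ((τ : ℂ) * w).re = τ * w.re := by
    rw [← Complex.ofReal_ratCast, Complex.re_ofReal_mul]
  rw [this]

lemma hasDerivAt_term (g : HahnSeries ℚ ℂ) (w : ℂ) (τ : ℚ) :
    HasDerivAt (fun z => term g z τ) (τ * term g w τ) w := by
  have h := (((hasDerivAt_id w).const_mul (τ : ℂ)).cexp).const_mul (g.coeff τ)
  refine h.congr_deriv ?_
  simp only [term, id]
  ring

lemma hasSum_term_ofPoly_mul (a : ℂ[X]) (g : HahnSeries ℚ ℂ) {w s : ℂ}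
    (h : HasSum (term g w) s) :
    HasSum (term (ofPoly a * g) w) (a.eval (Complex.exp w) * s) := by
  induction a using Polynomial.induction_on' with
  | add p q hp hq =>
    have h1 : term (ofPoly (p + q) * g) w =
        fun τ => term (ofPoly p * g) w τ + term (ofPoly q * g) w τ := by
      ext τ
      have : ofPoly (p + q) = ofPoly p + ofPoly q := map_add _ _ _
      simp [term, this, add_mul]
    rw [h1, eval_add, add_mul]
    exact hp.add hq
  | monomial n c =>
    rw [← (Equiv.addRight (n : ℚ)).hasSum_iff]
    have h1 : term (ofPoly (monomial n c) * g) w ∘ (Equiv.addRight (n : ℚ)) =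
        fun τ => (c * Complex.exp w ^ n) * term g w τ := by
      ext τ
      simp only [Function.comp_apply, Equiv.coe_addRight, term, ofPoly_monomial,
        HahnSeries.coeff_single_mul, add_sub_cancel_right, ← Complex.exp_nat_mul]
      have : ((τ + n : ℚ) : ℂ) * w = n * w + τ * w := by push_cast; ring
      rw [this, Complex.exp_add]
      ring
    rw [h1, eval_monomial]
    exact h.mul_left _

/-- Exponents may have either sign, so on a vertical strip each term is dominated by the sum of its
norms at the two real edge points, and the series may be differentiated termwise. The factor `exp w`
appears because `d/dw = ζ d/dζ`. -/
lemma summable_and_hasDerivAt_formalSum {g : HahnSeries ℚ ℂ} {R : ℝ}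
    (hg : ∀ w : ℂ, w.re < R → Summable (term g w)) {w : ℂ} (hw : w.re < R) :
    Summable (term (formalDeriv g) w) ∧
      HasDerivAt (formalSum g) (Complex.exp w * formalSum (formalDeriv g) w) w := by
  set r := (w.re + R) / 2 with hr
  let U : Set ℂ := {z | w.re - 1 < z.re ∧ z.re < r}
  have hU : IsOpen U := (isOpen_lt continuous_const Complex.continuous_re).inter
    (isOpen_lt Complex.continuous_re continuous_const)
  have hwU : w ∈ U := ⟨by linarith, by linarith⟩
  let u : ℚ → ℝ := fun τ => ‖term g ((w.re - 1 : ℝ) : ℂ) τ‖ + ‖term g (r : ℂ) τ‖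
  have hu : Summable u :=
    (hg _ (by rw [Complex.ofReal_re]; linarith)).norm.add
      (hg _ (by rw [Complex.ofReal_re]; linarith)).norm
  have hF : ∀ (τ : ℚ) (z : ℂ), z ∈ U → ‖term g z τ‖ ≤ u τ := by
    rintro τ z ⟨h1, h2⟩
    simp only [u, norm_term, Complex.ofReal_re, ← mul_add]
    gcongr
    rcases le_total 0 (τ : ℝ) with h | h
    · exact le_add_of_nonneg_of_le (Real.exp_pos _).le
        (Real.exp_le_exp.mpr (mul_le_mul_of_nonneg_left h2.le h))
    · exact le_add_of_le_of_nonneg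
        (Real.exp_le_exp.mpr (mul_le_mul_of_nonpos_left h1.le h)) (Real.exp_pos _).le
  have hdiff : ∀ τ, DifferentiableOn ℂ (fun z => term g z τ) U := fun τ z _ =>
    (hasDerivAt_term g z τ).differentiableAt.differentiableWithinAt
  have hd := Complex.hasSum_deriv_of_summable_norm hu hdiff hU hF hwU
  have hD := Complex.differentiableOn_tsum_of_summable_norm hu hdiff hU hF
  have hs : HasSum (fun σ => Complex.exp w * term (formalDeriv g) w σ)
      (deriv (formalSum g) w) := by
    rw [← (Equiv.addRight (1 : ℚ)).hasSum_iff] at hd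
    refine Eq.subst (motive := fun F => HasSum F _) (funext fun σ => ?_) hd
    simp only [Function.comp_apply, Equiv.coe_addRight, (hasDerivAt_term g w _).deriv]
    have : ((σ + 1 : ℚ) : ℂ) * w = w + σ * w := by push_cast; ring
    simp only [term, formalDeriv, this, Complex.exp_add]
    ring
  refine ⟨(summable_mul_left_iff (Complex.exp_ne_zero w)).mp hs.summable, ?_⟩
  have h1 : deriv (formalSum g) w = Complex.exp w * formalSum (formalDeriv g) w := by
    rw [← hs.tsum_eq, tsum_mul_left]; rfl
  rw [← h1]
  exact ((hD w hwU).differentiableAt (hU.mem_nhds hwU)).hasDerivAt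

lemma summable_iterate_formalDeriv {g : HahnSeries ℚ ℂ} {R : ℝ}
    (hg : ∀ w : ℂ, w.re < R → Summable (term g w)) (i : ℕ) :
    ∀ w : ℂ, w.re < R → Summable (term (formalDeriv^[i] g) w) := by
  induction i with
  | zero => exact hg
  | succ i ih =>
    intro w hw
    rw [Function.iterate_succ_apply']
    exact (summable_and_hasDerivAt_formalSum ih hw).1

lemma differentiableOn_formalSum {g : HahnSeries ℚ ℂ} {R : ℝ}
    (hg : ∀ w : ℂ, w.re < R → Summable (term g w)) :
    DifferentiableOn ℂ (formalSum g) {w | w.re < R} := fun _ hw =>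
  (summable_and_hasDerivAt_formalSum hg hw).2.differentiableAt.differentiableWithinAt

lemma sum_eval_mul_formalSum_eq_zero {H : ℂ[X][X]} {g : HahnSeries ℚ ℂ} {R : ℝ}
    (hg : ∀ w : ℂ, w.re < R → Summable (term g w)) (hH : applyOp H g = 0) {w : ℂ}
    (hw : w.re < R) :
    ∑ i ∈ Finset.range (H.natDegree + 1),
      (H.coeff i).eval (Complex.exp w) * formalSum (formalDeriv^[i] g) w = 0 := by
  have h1 : HasSum (fun τ => ∑ i ∈ Finset.range (H.natDegree + 1),
      term (ofPoly (H.coeff i) * formalDeriv^[i] g) w τ) (∑ i ∈ Finset.range (H.natDegree + 1),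
      (H.coeff i).eval (Complex.exp w) * formalSum (formalDeriv^[i] g) w) :=
    hasSum_sum fun i _ =>
      hasSum_term_ofPoly_mul _ _ (summable_iterate_formalDeriv hg i w hw).hasSum
  refine h1.unique ?_
  have h2 : ∀ τ, ∑ i ∈ Finset.range (H.natDegree + 1),
      term (ofPoly (H.coeff i) * formalDeriv^[i] g) w τ = 0 := by
    intro τ
    have h3 : (applyOp H g).coeff τ = 0 := by rw [hH]; rfl
    rw [applyOp, HahnSeries.coeff_sum] at h3
    simp only [term]
    rw [← Finset.sum_mul, h3, zero_mul]
  simp only [h2]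
  exact hasSum_zero

/-- The branch of the logarithm near `exp w₀` with value `w₀` at `exp w₀`. -/
def logAt (w₀ z : ℂ) : ℂ := w₀ + Complex.log (z * Complex.exp (-w₀))

lemma logAt_exp (w₀ : ℂ) : logAt w₀ (Complex.exp w₀) = w₀ := by
  simp [logAt, ← Complex.exp_add]

lemma exp_logAt (w₀ : ℂ) {z : ℂ} (hz : z ≠ 0) : Complex.exp (logAt w₀ z) = z := by
  rw [logAt, Complex.exp_add, Complex.exp_log (mul_ne_zero hz (Complex.exp_ne_zero _)),
    mul_comm z, ← mul_assoc, ← Complex.exp_add]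
  simp

lemma eventually_logAt_exp (w₀ : ℂ) : ∀ᶠ w in 𝓝 w₀, logAt w₀ (Complex.exp w) = w := by
  have hc : Continuous fun w : ℂ => (w - w₀).im := by fun_prop
  have h1 : ∀ᶠ w in 𝓝 w₀, -Real.pi < (w - w₀).im :=
    hc.continuousAt.eventually_const_lt (by simp [Real.pi_pos])
  have h2 : ∀ᶠ w in 𝓝 w₀, (w - w₀).im < Real.pi :=
    hc.continuousAt.eventually_lt_const (by simp [Real.pi_pos])
  filter_upwards [h1, h2] with w h1 h2
  rw [logAt, ← Complex.exp_add, ← sub_eq_add_neg, Complex.log_exp h1 h2.le]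
  ring

lemma hasDerivAt_logAt (w₀ : ℂ) {z : ℂ} (hz : z * Complex.exp (-w₀) ∈ Complex.slitPlane) :
    HasDerivAt (logAt w₀) z⁻¹ z := by
  have h := (((hasDerivAt_id z).mul_const (Complex.exp (-w₀))).clog hz).const_add w₀
  refine h.congr_deriv ?_
  simp only [id, one_mul]
  rw [mul_comm, div_mul_cancel_left₀ (Complex.exp_ne_zero _)]

lemma eventually_mem_slitPlane (w₀ : ℂ) :
    ∀ᶠ z in 𝓝 (Complex.exp w₀), z * Complex.exp (-w₀) ∈ Complex.slitPlane := by
  have hc : Continuous fun z : ℂ => z * Complex.exp (-w₀) := by fun_prop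
  refine hc.continuousAt.eventually (Complex.isOpen_slitPlane.mem_nhds ?_)
  simp [← Complex.exp_add]

/-- The sum of a formal solution, in the variable `ζ`, is an analytic solution. -/
lemma isSolutionAt_formalSum {H : ℂ[X][X]} {g : HahnSeries ℚ ℂ} {R : ℝ}
    (hg : ∀ w : ℂ, w.re < R → Summable (term g w)) (hH : applyOp H g = 0) {w₀ : ℂ}
    (hw₀ : w₀.re < R) :
    IsSolutionAt H (fun z => formalSum g (logAt w₀ z)) (Complex.exp w₀) := by
  have hslit := eventually_mem_slitPlane w₀
  have hre : ∀ᶠ z in 𝓝 (Complex.exp w₀), (logAt w₀ z).re < R := by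
    have hc : ContinuousAt (fun z => (logAt w₀ z).re) (Complex.exp w₀) :=
      Complex.continuous_re.continuousAt.comp
        (hasDerivAt_logAt w₀ hslit.self_of_nhds).continuousAt
    exact hc.eventually_lt_const (by simpa only [logAt_exp] using hw₀)
  have hne : ∀ᶠ z in 𝓝 (Complex.exp w₀), z ≠ 0 :=
    isOpen_ne.mem_nhds (Complex.exp_ne_zero w₀)
  have hder : ∀ i : ℕ, ∀ᶠ z in 𝓝 (Complex.exp w₀),
      HasDerivAt (fun z => formalSum (formalDeriv^[i] g) (logAt w₀ z))
        (formalSum (formalDeriv^[i + 1] g) (logAt w₀ z)) z := by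
    intro i
    filter_upwards [hslit, hre, hne] with z h1 h2 h3
    have h := (summable_and_hasDerivAt_formalSum (summable_iterate_formalDeriv hg i) h2).2.comp z
      (hasDerivAt_logAt w₀ h1)
    refine h.congr_deriv ?_
    rw [exp_logAt w₀ h3, Function.iterate_succ_apply']
    field_simp
  have hiter : ∀ i : ℕ, deriv^[i] (fun z => formalSum g (logAt w₀ z)) =ᶠ[𝓝 (Complex.exp w₀)]
      fun z => formalSum (formalDeriv^[i] g) (logAt w₀ z) := by
    intro i
    induction i with
    | zero => exact Filter.EventuallyEq.rfl
    | succ i ih =>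
      rw [Function.iterate_succ_apply']
      filter_upwards [ih.deriv, hder i] with z h1 h2
      rw [h1, h2.deriv]
  refine ⟨Complex.analyticAt_iff_eventually_differentiableAt.mpr
    ((hder 0).mono fun z hz => hz.differentiableAt), ?_⟩
  have hall : ∀ᶠ z in 𝓝 (Complex.exp w₀), ∀ i ∈ Finset.range (H.natDegree + 1),
      deriv^[i] (fun z => formalSum g (logAt w₀ z)) z =
        formalSum (formalDeriv^[i] g) (logAt w₀ z) :=
    (Finset.eventually_all _).mpr fun i _ => hiter i
  filter_upwards [hall, hre, hne] with z h1 h2 h3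
  rw [← sum_eval_mul_formalSum_eq_zero hg hH h2]
  refine Finset.sum_congr rfl fun i hi => ?_
  rw [h1 i hi, exp_logAt w₀ h3]

theorem continuableOff_formalSum {H : ℂ[X][X]} {g : HahnSeries ℚ ℂ} {R : ℝ}
    (hg : ∀ w : ℂ, w.re < R → Summable (term g w)) (hH : applyOp H g = 0) :
    ContinuableOff (formalSum g) R (singularPoints H) := by
  intro w₀ hw₀ γ hγ0 hγ
  have hsol := isSolutionAt_formalSum hg hH hw₀
  rw [← hγ0] at hsol
  obtain ⟨F, hF, hF0⟩ := hsol.exists_continuationAlong γ hγ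
  refine ⟨F, hF, ?_⟩
  rw [hγ0] at hF0
  filter_upwards [Complex.continuous_exp.continuousAt.eventually hF0, eventually_logAt_exp w₀]
    with w h1 h2
  rw [h1, h2]

/-! ### Behaviour at the origin -/

/-- The exponents of `g` are `> -1` and have the common denominator `N`. -/
def IsIntegrableType (g : HahnSeries ℚ ℂ) (N : ℕ) : Prop :=
  ∀ τ : ℚ, g.coeff τ ≠ 0 → ∃ k : ℕ, τ = ((k + 1 : ℕ) : ℚ) / N - 1

lemma isIntegrableType_borelTransform {f : HahnSeries ℚ ℂ} {N : ℕ} (hN : 0 < N)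
    (hf : ∀ σ ∈ f.support, ∃ k : ℤ, σ = (k : ℚ) / (N : ℚ))
    (hpos : ∀ σ : ℚ, σ ≤ 0 → f.coeff σ = 0) : IsIntegrableType (borelTransform f) N := by
  intro τ hτ
  have hτ' : f.coeff (τ + 1) ≠ 0 := right_ne_zero_of_mul hτ
  obtain ⟨k, hk⟩ := hf (τ + 1) hτ'
  have h0 : 0 < τ + 1 := by
    by_contra! h
    exact hτ' (hpos _ h)
  have hN' : (0 : ℚ) < N := by exact_mod_cast hN
  have hk0 : 0 < k := by
    rw [hk] at h0
    exact_mod_cast (div_pos_iff_of_pos_right hN').mp h0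
  obtain ⟨m, rfl⟩ : ∃ m : ℕ, k = m + 1 := ⟨(k - 1).toNat, by omega⟩
  refine ⟨m, ?_⟩
  rw [eq_sub_iff_add_eq, hk]
  push_cast
  rfl

lemma formalSum_periodic {g : HahnSeries ℚ ℂ} {N : ℕ} (hN : 0 < N) (hg : IsIntegrableType g N)
    (w : ℂ) : formalSum g (w - 2 * Real.pi * Complex.I * N) = formalSum g w := by
  refine tsum_congr fun τ => ?_
  by_cases hτ : g.coeff τ = 0
  · simp [term, hτ]
  · obtain ⟨k, rfl⟩ := hg τ hτ
    have hN' : (N : ℂ) ≠ 0 := by exact_mod_cast hN.ne'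
    rw [term, term]
    congr 1
    rw [Complex.exp_eq_exp_iff_exists_int]
    -- This integer is `-τ N`.
    refine ⟨(N : ℤ) - (k + 1), ?_⟩
    push_cast
    field_simp
    ring

/-- All exponents are at least `s = 1/N - 1`, so moving left from `R` to `Re w` multiplies each term
by at most `exp (s (Re w - R))`. -/
lemma norm_formalSum_le {g : HahnSeries ℚ ℂ} {N : ℕ} (hN : 0 < N) (hg : IsIntegrableType g N)
    {R : ℝ} (hR : Summable (term g (R : ℂ))) :
    ∃ C : ℝ, ∀ w : ℂ, w.re < R →
      ‖formalSum g w‖ ≤ C * Real.exp ((1 / N - 1) * w.re) := by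
  set s : ℝ := 1 / N - 1 with hs
  refine ⟨(∑' τ, ‖term g (R : ℂ) τ‖) * Real.exp (-(s * R)), fun w hw => ?_⟩
  have h1 : ∀ τ, ‖term g w τ‖ ≤ ‖term g (R : ℂ) τ‖ * Real.exp (s * (w.re - R)) := by
    intro τ
    by_cases hτ : g.coeff τ = 0
    · simp [term, hτ]
    · obtain ⟨k, hk⟩ := hg τ hτ
      have hτs : s ≤ τ := by
        rw [hk]
        push_cast
        rw [hs]
        gcongr
        linarith [(Nat.cast_nonneg k : (0 : ℝ) ≤ k)]
      rw [norm_term, norm_term, mul_assoc, ← Real.exp_add, Complex.ofReal_re]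
      gcongr
      nlinarith
  have hsum := hR.norm.mul_right (Real.exp (s * (w.re - R)))
  calc ‖formalSum g w‖ ≤ ∑' τ, ‖term g (R : ℂ) τ‖ * Real.exp (s * (w.re - R)) :=
        tsum_of_norm_bounded hsum.hasSum h1
    _ = _ := by
      rw [tsum_mul_right, mul_assoc, ← Real.exp_add]
      ring_nf

lemma integrableOn_of_norm_le {φ : ℂ → ℂ} {R C s : ℝ} (hs : -1 < s)
    (hφ : DifferentiableOn ℂ φ {w | w.re < R})
    (hC : ∀ w : ℂ, w.re < R → ‖φ w‖ ≤ C * Real.exp (s * w.re)) (θ : ℝ) :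
    MeasureTheory.IntegrableOn (fun t : ℝ => φ ((Real.log t : ℂ) + (θ : ℂ) * Complex.I))
      (Set.Ioo 0 (Real.exp R)) := by
  have hre : ∀ t : ℝ, ((Real.log t : ℂ) + (θ : ℂ) * Complex.I).re = Real.log t := by
    intro t; simp
  have hlog : ∀ t ∈ Set.Ioo 0 (Real.exp R), Real.log t < R := fun t ht =>
    (Real.log_lt_iff_lt_exp ht.1).mpr ht.2
  have hint : MeasureTheory.IntegrableOn (fun t : ℝ => C * t ^ s) (Set.Ioo 0 (Real.exp R)) :=
    ((intervalIntegral.integrableOn_Ioo_rpow_iff (Real.exp_pos R)).mpr hs).const_mul C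
  refine MeasureTheory.Integrable.mono' hint ?_ ?_
  · refine ContinuousOn.aestronglyMeasurable ?_ measurableSet_Ioo
    refine hφ.continuousOn.comp ?_ fun t ht => (hre t).trans_lt (hlog t ht)
    refine ContinuousOn.add ?_ continuousOn_const
    exact Complex.continuous_ofReal.comp_continuousOn
      (Real.continuousOn_log.mono fun t ht => ht.1.ne')
  · refine (MeasureTheory.ae_restrict_iff' measurableSet_Ioo).mpr (Filter.Eventually.of_forall ?_)
    intro t ht
    refine (hC _ (by rw [hre]; exact hlog t ht)).trans_eq ?_
    rw [hre, Real.rpow_def_of_pos ht.1, mul_comm s]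

lemma tendsto_linear_mul_exp_neg (a b : ℝ) :
    Filter.Tendsto (fun y : ℝ => (a * y + b) * Real.exp (-y)) Filter.atTop (𝓝 0) := by
  have h1 := (Real.tendsto_pow_mul_exp_neg_atTop_nhds_zero 1).const_mul a
  have h2 := (Real.tendsto_pow_mul_exp_neg_atTop_nhds_zero 0).const_mul b
  have h3 := h1.add h2
  simp only [mul_zero, add_zero, pow_one, pow_zero, one_mul] at h3
  refine h3.congr fun y => ?_
  ring

/-- A function with finite monodromy of order `N` has an explicit major. -/
lemma exists_isIntegrableMajor {φ : ℂ → ℂ} {R C : ℝ} {N : ℕ} (hN : 0 < N)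
    (hφ : DifferentiableOn ℂ φ {w | w.re < R})
    (hper : ∀ w, φ (w - 2 * Real.pi * Complex.I * N) = φ w)
    (hC : ∀ w : ℂ, w.re < R → ‖φ w‖ ≤ C * Real.exp ((1 / N - 1) * w.re)) :
    ∃ χ : ℂ → ℂ, IsIntegrableMajor χ φ R := by
  set c : ℂ := 2 * Real.pi * Complex.I with hc
  have hc0 : c ≠ 0 := Complex.two_pi_I_ne_zero
  have hN0 : (N : ℂ) ≠ 0 := by exact_mod_cast hN.ne'
  have hre : ∀ (w : ℂ) (j : ℕ), (w - c * j).re = w.re := by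
    intro w j; simp [hc]
  -- A turn by `-c` sends `T w j` to `T w (j + 1)`, so the difference of the two sums telescopes to
  -- `T w 0 - T w N`. By periodicity this is `φ w`, the two weights differing by `1`.
  let T : ℂ → ℕ → ℂ := fun w j => (w / (c * N) - j / N) * φ (w - c * j)
  refine ⟨fun w => ∑ j ∈ Finset.range N, T w j, ?_, ?_, ?_⟩
  · refine DifferentiableOn.fun_sum fun j _ => DifferentiableOn.mul ?_ ?_
    · exact ((differentiable_id.div_const _).sub_const _).differentiableOn
    · refine hφ.comp (differentiable_id.sub_const _).differentiableOn fun w hw => ?_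
      change (w - c * j).re < R
      rw [hre]; exact hw
  · intro w _
    have h1 : ∀ j, T (w - c) j = T w (j + 1) := by
      intro j
      simp only [T]
      congr 1
      · push_cast; field_simp; ring
      · congr 1; push_cast; ring
    have h2 : T w 0 - T w N = φ w := by
      simp only [T]
      rw [hper]
      simp only [Nat.cast_zero, mul_zero, sub_zero, zero_div]
      field_simp
      ring
    change φ w = ∑ j ∈ Finset.range N, T w j - ∑ j ∈ Finset.range N, T (w - c) j
    simp only [h1]
    rw [← Finset.sum_sub_distrib, Finset.sum_range_sub', h2]
  · intro A ε hε
    have hNr : (0 : ℝ) < N := by exact_mod_cast hN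
    -- In terms of `y = -Re w / N`, the logarithmic weights are linear in `y` while `ζ φ` is of size
    -- `exp (-y)`.
    have hlim := (tendsto_linear_mul_exp_neg (N * (C * N)) (N * (C * (A + 1)))).eventually_lt_const
      hε
    obtain ⟨Y, hY⟩ := Filter.eventually_atTop.mp hlim
    refine ⟨min (min R 0) (-(N * Y)), fun w hw him => ?_⟩
    have hwR : w.re < R := hw.trans_le ((min_le_left _ _).trans (min_le_left _ _))
    have hw0 : w.re < 0 := hw.trans_le ((min_le_left _ _).trans (min_le_right _ _))
    have hwY : w.re < -(N * Y) := hw.trans_le (min_le_right _ _)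
    have hy : Y ≤ -w.re / N := by
      rw [le_div_iff₀ hNr]; linarith
    have hnw : ‖w‖ ≤ -w.re + A := by
      have := Complex.norm_le_abs_re_add_abs_im w
      rw [abs_of_neg hw0] at this
      linarith
    have hcN : 1 ≤ ‖c * N‖ := by
      have : ‖c * N‖ = 2 * Real.pi * N := by
        simp [hc, abs_of_pos Real.pi_pos]
      rw [this]
      have h1 : (1 : ℝ) ≤ N := by exact_mod_cast hN
      nlinarith [Real.pi_gt_three]
    have hterm : ∀ j ∈ Finset.range N, ‖Complex.exp w * T w j‖ ≤
        (-w.re + A + 1) * (C * Real.exp (w.re / N)) := by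
      intro j hj
      have hjN : (j : ℝ) ≤ N := by exact_mod_cast (Finset.mem_range.mp hj).le
      have e1 : ‖w / (c * N) - j / N‖ ≤ -w.re + A + 1 := by
        refine (norm_sub_le _ _).trans (add_le_add ?_ ?_)
        · rw [norm_div]
          exact (div_le_self (norm_nonneg _) hcN).trans hnw
        · rw [norm_div, Complex.norm_natCast, Complex.norm_natCast]
          exact div_le_one_of_le₀ hjN hNr.le
      have e2 : ‖Complex.exp w‖ * ‖φ (w - c * j)‖ ≤ C * Real.exp (w.re / N) := by
        have h := hC (w - c * j) (by rw [hre]; exact hwR)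
        rw [hre] at h
        calc _ ≤ Real.exp w.re * (C * Real.exp ((1 / N - 1) * w.re)) := by
              rw [Complex.norm_exp]; gcongr
          _ = C * (Real.exp w.re * Real.exp ((1 / N - 1) * w.re)) := by ring
          _ = _ := by rw [← Real.exp_add]; ring_nf
      simp only [T]
      rw [norm_mul, norm_mul]
      calc _ = ‖w / (c * N) - j / N‖ * (‖Complex.exp w‖ * ‖φ (w - c * j)‖) := by ring
        _ ≤ _ := by gcongr
                    exact (norm_nonneg _).trans e1
    calc ‖Complex.exp w * ∑ j ∈ Finset.range N, T w j‖
        ≤ ∑ j ∈ Finset.range N, ‖Complex.exp w * T w j‖ := by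
          rw [Finset.mul_sum]; exact norm_sum_le _ _
      _ ≤ ∑ _j ∈ Finset.range N, (-w.re + A + 1) * (C * Real.exp (w.re / N)) :=
          Finset.sum_le_sum hterm
      _ = (N * (C * N) * (-w.re / N) + N * (C * (A + 1))) * Real.exp (-(-w.re / N)) := by
          rw [Finset.sum_const, Finset.card_range, nsmul_eq_mul, neg_div, neg_neg]
          field_simp
          ring
      _ < ε := hY _ hy

/-! ### Convergence of the Borel transform -/

lemma summable_borelTransform {f : HahnSeries ℚ ℂ} {N : ℕ} (hN : 0 < N)
    (hf : IsIntegrableType (borelTransform f) N) (hgrowth : GeometricGrowth f) :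
    ∃ R : ℝ, ∀ w : ℂ, w.re < R → Summable (term (borelTransform f) w) := by
  obtain ⟨A, B, hA, hB, hAB⟩ := hgrowth
  refine ⟨-Real.log B, fun w hw => ?_⟩
  have hNr : (0 : ℝ) < N := by exact_mod_cast hN
  have hNq : (N : ℚ) ≠ 0 := by exact_mod_cast hN.ne'
  let e : ℕ → ℚ := fun k => ((k + 1 : ℕ) : ℚ) / N - 1
  have he : Function.Injective e := by
    intro a b hab
    have h1 : ((a + 1 : ℕ) : ℚ) / N = ((b + 1 : ℕ) : ℚ) / N := sub_left_injective hab
    have h2 : ((a + 1 : ℕ) : ℚ) = ((b + 1 : ℕ) : ℚ) := (div_left_inj' hNq).mp h1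
    have h3 : a + 1 = b + 1 := by exact_mod_cast h2
    omega
  have hzero : ∀ τ ∉ Set.range e, term (borelTransform f) w τ = 0 := by
    intro τ hτ
    have : (borelTransform f).coeff τ = 0 := by
      by_contra h
      obtain ⟨k, hk⟩ := hf τ h
      exact hτ ⟨k, hk.symm⟩
    simp [term, this]
  rw [← he.summable_iff hzero]
  -- With exponents `(k + 1)/N - 1`, the terms are dominated by a geometric series of ratio `q =
  -- (B|ζ|)^(1/N)`, which is below `1` exactly when `|ζ| < 1/B`.
  set q := Real.exp ((Real.log B + w.re) / N) with hq
  have hq1 : q < 1 := by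
    rw [hq, Real.exp_lt_one_iff]
    exact div_neg_of_neg_of_pos (by linarith) hNr
  have hgeo := ((summable_geometric_of_lt_one (Real.exp_pos _).le hq1).mul_right q).mul_left
    (A * Real.exp (-w.re))
  refine Summable.of_norm_bounded hgeo fun k => ?_
  have hσ : (0 : ℚ) < e k + 1 := by
    simp only [e, sub_add_cancel]
    positivity
  have h1 := hAB _ hσ
  have h2 : (borelTransform f).coeff (e k) =
      f.coeff (e k + 1) / Complex.Gamma ((e k + 1 : ℚ) : ℂ) := by
    rw [div_eq_inv_mul]; rfl
  have h3 : ((e k : ℚ) : ℝ) = ((k : ℝ) + 1) / N - 1 := by simp [e]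
  rw [Function.comp_apply, norm_term, h2]
  calc _ ≤ A * B ^ ((e k + 1 : ℚ) : ℝ) * Real.exp (e k * w.re) := by gcongr
    _ = A * Real.exp (-w.re) * (q ^ k * q) := by
      rw [← pow_succ, hq, ← Real.exp_nat_mul, Real.rpow_def_of_pos hB, mul_assoc, mul_assoc,
        ← Real.exp_add, ← Real.exp_add]
      congr 2
      push_cast
      rw [h3]
      field_simp
      ring

lemma finite_singularPoints {H : ℂ[X][X]} (hH : H ≠ 0) : (singularPoints H).Finite :=
  H.leadingCoeff.roots.toFinset.finite_toSet.subset fun z (hz : H.leadingCoeff.eval z = 0) => by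
    simpa [hH] using hz

theorem isIntegrableResurgent_formalSum {g : HahnSeries ℚ ℂ} {N : ℕ} (hN : 0 < N)
    (hg : IsIntegrableType g N) {R : ℝ} (hR : ∀ w : ℂ, w.re < R → Summable (term g w))
    {H : ℂ[X][X]} (hH : H ≠ 0) (hHg : applyOp H g = 0) :
    IsIntegrableResurgent (formalSum g) (singularPoints H) := by
  have hfin := finite_singularPoints hH
  -- Shrinking the half plane gives absolute convergence at its real edge point, as the norm bound
  -- requires.
  have hR' : ∀ w : ℂ, w.re < R - 1 → Summable (term g w) := fun w hw => hR w (by linarith)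
  obtain ⟨C, hC⟩ := norm_formalSum_le hN hg (R := R - 1)
    (hR _ (by rw [Complex.ofReal_re]; linarith))
  have hd := differentiableOn_formalSum hR'
  refine ⟨hfin.isClosed, hfin.isDiscrete, R - 1, hd, ?_, ?_, continuableOff_formalSum hR' hHg⟩
  · refine integrableOn_of_norm_le ?_ hd hC
    have : (0 : ℝ) < 1 / N := by positivity
    linarith
  · exact exists_isIntegrableMajor hN hd (formalSum_periodic hN hg) hC

end Resurgence

end

theorem mainTheorem9 (f : HahnSeries ℚ ℂ) (hf : Resurgence.IsPuiseux f)
    (hpos : ∀ σ : ℚ, σ ≤ 0 → f.coeff σ = 0) (hol : Resurgence.IsHolonomic f) :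
    Resurgence.IsHolonomic (Resurgence.borelTransform f) ∧
    (Resurgence.GeometricGrowth f →
      (∃ R : ℝ, ∀ w : ℂ, w.re < R → Summable (Resurgence.term (Resurgence.borelTransform f) w)) ∧
      ∀ H : Polynomial (Polynomial ℂ), H ≠ 0 → Resurgence.applyOp H (Resurgence.borelTransform f) = 0 →
        (Resurgence.singularPoints H).Finite ∧
        Resurgence.IsIntegrableResurgent (Resurgence.formalSum (Resurgence.borelTransform f))
          (Resurgence.singularPoints H)) := by
  refine ⟨Resurgence.isHolonomic_borelTransform f hpos hol, fun hgrowth => ?_⟩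
  obtain ⟨N, hN, hfN⟩ := hf
  have htype := Resurgence.isIntegrableType_borelTransform hN hfN hpos
  obtain ⟨R, hR⟩ := Resurgence.summable_borelTransform hN htype hgrowth
  exact ⟨⟨R, hR⟩, fun H hH hHf => ⟨Resurgence.finite_singularPoints hH,
    Resurgence.isIntegrableResurgent_formalSum hN htype hR hH hHf⟩⟩
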